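/- Let $S$ be a nonempty finite set of $n$ agents. For a nonempty finite set $W$ of qubits, call a state a \emph{pure maximally entangled state} of $W$ if it is the image under a local unitary $\bigotimes_{w\in W}U_w$ of $(|00\cdots0\rangle+|11\cdots1\rangle)/\sqrt2\in(\mathbb C^2)^{\otimes W}$. An \emph{entangled hypergraph} on $S$ consists of finitely many nonempty subsets $E_1,\dots,E_m\subseteq S$ (not necessarily distinct) and, for each $j$, a pure maximally entangled state $\varphi_j$ of $|E_j|$ qubits, one held by each agent in $E_j$; the agents initially share $\varphi_1\otimes\cdots\otimes\varphi_m$ and nothing else. It is \emph{connected} if the hypergraph $(S,\{E_1,\dots,E_m\})$ is: for every two distinct agents $a,b$ there is a sequence $F_1,\dots,F_\ell$ ($\ell\ge1$) of hyperedges with $a\in F_1$, $b\in F_\ell$ and $F_i\cap F_{i+1}\neq\emptyset$ for $1\le i<\ell$. An LOCC protocol consists of finitely many rounds; in each round every agent performs on the system it holds a local operation (a generalized measurement given by finitely many Kraus operators $K_i$ with $\sum_iK_i^\dagger K_i=1$; this includes unitaries, adding ancillas, and discarding subsystems), the outcomes are announced to all agents, and later operations may depend on all earlier outcomes. Theorem.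 Let $\psi$ be any pure maximally entangled state of $n$ qubits, one for each agent. Then $\psi$ can be prepared among the $n$ agents, exactly and with certainty, from the initial state of an entangled hypergraph on $S$ by an LOCC protocol if and only if the entangled hypergraph is connected. (In particular, some $n$-partite pure maximally entangled state can be prepared if and only if the entangled hypergraph is connected, and then every one can.) -/

import Mathlib

open scoped Matrix

noncomputable section

/-- A finite-dimensional quantum system, given by a finite set labelling an orthonormal basis of
its Hilbert space: the Hilbert space is `ℂ ^ basis`. -/
structure QSystem where
  basis : Type
  [fintypeBasis : Fintype basis]
  [decidableEqBasis : DecidableEq basis]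

attribute [instance] QSystem.fintypeBasis QSystem.decidableEqBasis

/-- The qubit, with computational basis `|0⟩, |1⟩`. -/
def QSystem.qubit : QSystem where
  basis := Fin 2

/-- The tensor product `⨂ w, K w` of a family of operators, as a matrix in the product bases. -/
def tensorOp {W : Type*} [Fintype W] {α β : W → Type*} (K : ∀ w, Matrix (β w) (α w) ℂ) :
    Matrix (∀ w, β w) (∀ w, α w) ℂ :=
  Matrix.of fun y x => ∏ w, K w (y w) (x w)

/-- The vector `(|00…0⟩ + |11…1⟩) / √2` of one qubit for each element of `W`. -/
def ghz (W : Type*) [Fintype W] : (W → Fin 2) → ℂ :=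
  fun x => ((if x = fun _ => 0 then 1 else 0) + (if x = fun _ => 1 then 1 else 0)) /
    ((Real.sqrt 2 : ℝ) : ℂ)

/-- Pure maximally entangled states of the qubits labelled by `W`: the images of
`(|00…0⟩ + |11…1⟩) / √2` under local unitaries. -/
def IsMaxEntangled {W : Type*} [Fintype W] [DecidableEq W] (ψ : (W → Fin 2) → ℂ) : Prop :=
  ∃ U : W → Matrix.unitaryGroup (Fin 2) ℂ,
    ψ = tensorOp (fun w => (U w : Matrix (Fin 2) (Fin 2) ℂ)) *ᵥ ghz W

/-- The density matrix `|ψ⟩⟨ψ|`. -/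
def pureState {X : Type*} (ψ : X → ℂ) : Matrix X X ℂ := Matrix.vecMulVec ψ (star ψ)

/-- Finite LOCC protocols among the agents `V`, where agent `w` holds the system `A w` at the
start and `B w` at the end. In a round every agent `w` performs a local generalized measurement
with Kraus operators `K w i`, and all outcomes are announced; the rest of the protocol may depend
on them. Local unitaries, adding ancillas, projective measurements, discarding subsystems
(a measurement whose outcome is ignored later), local randomness and doing nothing are all special
cases of such a measurement. -/
inductive LOCC {V : Type*} [Fintype V] [DecidableEq V] : (V → QSystem) → (V → QSystem) → Type _
  | done (A : V → QSystem) : LOCC A A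
  | round {A B C : V → QSystem} (o : V → ℕ)
      (K : ∀ w, Fin (o w) → Matrix (B w).basis (A w).basis ℂ)
      (complete : ∀ w, ∑ i, (K w i)ᴴ * K w i = 1)
      (next : (∀ w, Fin (o w)) → LOCC B C) : LOCC A C

/-- The final density matrix of a protocol: the sum over all sequences of outcomes of the
unnormalized final states, that is, the average of the final states. -/
def LOCC.run {V : Type*} [Fintype V] [DecidableEq V] {A B : V → QSystem} (P : LOCC A B) :
    Matrix (∀ w, (A w).basis) (∀ w, (A w).basis) ℂ →
      Matrix (∀ w, (B w).basis) (∀ w, (B w).basis) ℂ :=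
  match P with
  | .done _ => fun ρ => ρ
  | .round _ K _ next => fun ρ => ∑ k,
      (next k).run (tensorOp (fun w => K w (k w)) * ρ * (tensorOp (fun w => K w (k w)))ᴴ)

/-- The pure state `ψ` can be prepared (exactly, with certainty) from `φ` by LOCC. -/
def LOCCPreparable {V : Type*} [Fintype V] [DecidableEq V] {A B : V → QSystem}
    (φ : (∀ w, (A w).basis) → ℂ) (ψ : (∀ w, (B w).basis) → ℂ) : Prop :=
  ∃ P : LOCC A B, P.run (pureState φ) = pureState ψ

/-- A hyperpath from `a` to `b`: a nonempty sequence `E₁, …, Eₗ` of hyperedges with `a ∈ E₁` and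
`b ∈ Eₗ`, consecutive members of which have a common vertex. -/
def Hypergraph.IsHyperpath {α : Type*} (G : Hypergraph α) (a b : α) (p : List (Set α)) : Prop :=
  (∀ e ∈ p, e ∈ G.edgeSet) ∧ (∃ e ∈ p.head?, a ∈ e) ∧ (∃ e ∈ p.getLast?, b ∈ e) ∧
    p.IsChain fun e f => (e ∩ f).Nonempty

/-- There is a hyperpath between every two vertices. -/
def Hypergraph.IsHyperconnected {α : Type*} (G : Hypergraph α) : Prop :=
  ∀ a ∈ G.vertexSet, ∀ b ∈ G.vertexSet, a ≠ b → ∃ p, G.IsHyperpath a b p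

/-- An entangled hypergraph on the agents `V`: hyperedges `edge 1, …, edge m`, and for each
hyperedge a pure maximally entangled state shared by the agents in it, one qubit each. -/
structure EntangledHypergraph (V : Type*) [Fintype V] [DecidableEq V] (m : ℕ) where
  edge : Fin m → Finset V
  edge_nonempty : ∀ j, (edge j).Nonempty
  state : ∀ j, (edge j → Fin 2) → ℂ
  isMaxEntangled_state : ∀ j, IsMaxEntangled (state j)

namespace EntangledHypergraph

variable {V : Type*} [Fintype V] [DecidableEq V] {m : ℕ} (H : EntangledHypergraph V m)

/-- Agent `v` initially holds one qubit for each hyperedge containing `v`. -/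
def system (v : V) : QSystem where
  basis := {j : Fin m // v ∈ H.edge j} → Fin 2

/-- The initial joint state: the tensor product over all hyperedges of the shared states. -/
def initialState : (∀ v, (H.system v).basis) → ℂ :=
  fun x => ∏ j, H.state j fun v => x v.1 ⟨j, v.2⟩

/-- The underlying hypergraph `(S, F)`: `S` is the set of all agents, `F = {E₁, …, Eₘ}`. -/
def toHypergraph : Hypergraph V where
  vertexSet := Set.univ
  edgeSet := Set.range fun j => (H.edge j : Set V)
  subset_vertexSet_of_mem_edgeSet' := fun _ _ => Set.subset_univ _

end EntangledHypergraph

end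

/-! Necessity: the agents reachable from `a` form a set `T` that no hyperedge crosses, so if `b` is
unreachable the initial state is a product across `T | Tᶜ`. Local Kraus operators keep mixtures of
product vectors inside the cone `separable T` (`LOCC.run_mem_separable`), whereas a coherence bound
valid on that cone excludes every maximally entangled state (`norm_apply_le_of_mem_separable`).

Sufficiency: after undoing the local unitaries, the amplitudes are supported on bit assignments
constant on each hyperedge. Every agent merges its qubits into one with a `parityKraus` measurement,
which keeps the relative parities as its outcome. Two surviving strings differ by a `z` constant on
each hyperedge, hence constant by connectivity, so known bit flips restore a multiple of the GHZ
vector. Its local unitary image is the target; preservation of trace shows that the weights sum to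
one. -/

open scoped Matrix

open Matrix

/-! ### Local operators, pure states, GHZ vectors and the trace -/

section TensorOp

variable {W : Type*} [Fintype W] [DecidableEq W] {α β γ : W → Type*}

theorem tensorOp_mul [∀ w, Fintype (β w)] (K : ∀ w, Matrix (γ w) (β w) ℂ)
    (L : ∀ w, Matrix (β w) (α w) ℂ) :
    tensorOp K * tensorOp L = tensorOp fun w => K w * L w := by
  ext y x
  simp only [tensorOp, mul_apply, of_apply, Finset.prod_univ_sum, Fintype.piFinset_univ,
    Finset.prod_mul_distrib]

omit [DecidableEq W] in
theorem conjTranspose_tensorOp (K : ∀ w, Matrix (β w) (α w) ℂ) :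
    (tensorOp K)ᴴ = tensorOp fun w => (K w)ᴴ := by
  ext y x
  simp [tensorOp, conjTranspose_apply]

theorem tensorOp_one [∀ w, DecidableEq (α w)] :
    tensorOp (fun w => (1 : Matrix (α w) (α w) ℂ)) = 1 := by
  ext y x
  simp only [tensorOp, of_apply, one_apply, Finset.prod_ite_zero, Finset.prod_const_one]
  simp [funext_iff]

theorem sum_tensorOp {ι : W → Type*} [∀ w, Fintype (ι w)]
    (K : ∀ w, ι w → Matrix (β w) (α w) ℂ) :
    ∑ k : ∀ w, ι w, tensorOp (fun w => K w (k w)) = tensorOp fun w => ∑ i, K w i := by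
  ext y x
  simp only [tensorOp, of_apply, Matrix.sum_apply, Finset.prod_univ_sum, Fintype.piFinset_univ]

theorem tensorOp_conjTranspose_mul_self [∀ w, Fintype (β w)] [∀ w, DecidableEq (α w)]
    (K : ∀ w, Matrix (β w) (α w) ℂ) (hK : ∀ w, (K w)ᴴ * K w = 1) :
    (tensorOp K)ᴴ * tensorOp K = 1 := by
  simp only [conjTranspose_tensorOp, tensorOp_mul, hK, tensorOp_one]

end TensorOp

section PureState

variable {X Y : Type*} [Fintype X]

theorem mul_pureState_mul_conjTranspose (M : Matrix Y X ℂ) (φ : X → ℂ) :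
    M * pureState φ * Mᴴ = pureState (M *ᵥ φ) := by
  rw [pureState, pureState, mul_vecMulVec, vecMulVec_mul, star_mulVec]

theorem trace_pureState (φ : X → ℂ) : (pureState φ).trace = star φ ⬝ᵥ φ := by
  rw [pureState, trace_vecMulVec, dotProduct_comm]

omit [Fintype X] in
theorem pureState_smul (c : ℂ) (φ : X → ℂ) :
    pureState (c • φ) = (c * star c) • pureState φ := by
  ext x y
  simp [pureState, vecMulVec_apply]
  ring

theorem star_mulVec_dotProduct_mulVec [Fintype Y] [DecidableEq X] {M : Matrix Y X ℂ}
    (hM : Mᴴ * M = 1) (φ : X → ℂ) : star (M *ᵥ φ) ⬝ᵥ (M *ᵥ φ) = star φ ⬝ᵥ φ := by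
  rw [star_mulVec, ← dotProduct_mulVec, mulVec_mulVec, hM, one_mulVec]

end PureState

section GHZ

variable {W : Type*} [Fintype W]

theorem ghz_const [Nonempty W] (b : Fin 2) :
    ghz W (fun _ => b) = 1 / ((Real.sqrt 2 : ℝ) : ℂ) := by
  fin_cases b <;> simp [ghz, funext_iff]

theorem ghz_eq_zero {x : W → Fin 2} (hx : ∀ b, x ≠ fun _ => b) : ghz W x = 0 := by
  simp [ghz, hx]

theorem ghz_add_one (x : W → Fin 2) : ghz W (fun w => x w + 1) = ghz W x := by
  have h (a b : Fin 2) : a + 1 = b ↔ a = b + 1 := by revert a b; decide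
  have e : (1 + 1 : Fin 2) = 0 := rfl
  simp only [ghz, funext_iff, h, zero_add, e]
  rw [add_comm]

theorem eq_const_of_ghz_ne_zero {x : W → Fin 2} (hx : ghz W x ≠ 0) : ∃ b, x = fun _ => b := by
  by_contra! h
  exact hx (ghz_eq_zero h)

theorem star_ghz_dotProduct_ghz [DecidableEq W] [Nonempty W] : star (ghz W) ⬝ᵥ ghz W = 1 := by
  have h01 : (fun _ : W => (0 : Fin 2)) ≠ fun _ => 1 := by simp [funext_iff]
  rw [dotProduct, Fintype.sum_eq_add _ _ h01]
  · have h : ((Real.sqrt 2 : ℝ) : ℂ) * ((Real.sqrt 2 : ℝ) : ℂ) = 2 := by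
      rw [← Complex.ofReal_mul, Real.mul_self_sqrt (by norm_num)]; norm_num
    have h0 : ((Real.sqrt 2 : ℝ) : ℂ) ≠ 0 := by simp
    simp only [Pi.star_apply, ghz_const, RCLike.star_def, map_div₀, map_one, Complex.conj_ofReal]
    field_simp
    rw [sq, h]; norm_num
  · rintro x ⟨hx0, hx1⟩
    rw [ghz_eq_zero (x := x), mul_zero]
    intro b
    fin_cases b
    exacts [hx0, hx1]

theorem IsMaxEntangled.star_dotProduct_self [DecidableEq W] [Nonempty W] {ψ : (W → Fin 2) → ℂ}
    (hψ : IsMaxEntangled ψ) : star ψ ⬝ᵥ ψ = 1 := by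
  obtain ⟨U, rfl⟩ := hψ
  rw [star_mulVec_dotProduct_mulVec, star_ghz_dotProduct_ghz]
  exact tensorOp_conjTranspose_mul_self _ fun w => mem_unitaryGroup_iff'.1 (U w).2

end GHZ

section Trace

variable {V : Type*} [Fintype V] [DecidableEq V]

/-- Cyclicity of the trace reduces each round to the completeness relation. This later spares
computing the probabilities of outcomes. -/
theorem LOCC.trace_run {A B : V → QSystem} (P : LOCC A B)
    (ρ : Matrix (∀ w, (A w).basis) (∀ w, (A w).basis) ℂ) : (P.run ρ).trace = ρ.trace := by
  induction P with
  | done A => rfl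
  | round o K complete next ih =>
    rw [LOCC.run, trace_sum]
    simp only [ih, trace_mul_cycle _ ρ]
    rw [← trace_sum, ← Finset.sum_mul]
    simp only [conjTranspose_tensorOp, tensorOp_mul]
    rw [sum_tensorOp (fun w i => (K w i)ᴴ * K w i)]
    simp only [complete, tensorOp_one, one_mul]

end Trace

/-! ### Separability across a cut -/

section Product

variable {V : Type*} {α β : V → Type*}

open Classical in
/-- The vector `φ` is a product vector across the cut `T | Tᶜ`: the `2 × 2` minors of its
matrix of coefficients vanish. -/
def IsProductAcross (T : Set V) (φ : (∀ v, α v) → ℂ) : Prop :=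
  ∀ x y, φ x * φ y = φ (T.piecewise x y) * φ (T.piecewise y x)

open Classical in
/-- Interchanging the components outside `T` of two families. -/
noncomputable def exchangeEquiv (T : Set V) : ((∀ v, α v) × (∀ v, α v)) ≃ ((∀ v, α v) × (∀ v, α v)) where
  toFun p := (T.piecewise p.1 p.2, T.piecewise p.2 p.1)
  invFun p := (T.piecewise p.1 p.2, T.piecewise p.2 p.1)
  left_inv p := by
    ext v <;> by_cases hv : v ∈ T <;> simp [hv]
  right_inv p := by
    ext v <;> by_cases hv : v ∈ T <;> simp [hv]

variable [Fintype V] [DecidableEq V]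

theorem IsProductAcross.tensorOp_mulVec [∀ v, Fintype (α v)] {T : Set V} {φ : (∀ v, α v) → ℂ}
    (hφ : IsProductAcross T φ) (K : ∀ v, Matrix (β v) (α v) ℂ) :
    IsProductAcross T (tensorOp K *ᵥ φ) := by
  classical
  intro x y
  simp only [mulVec, dotProduct, Finset.sum_mul_sum, ← Fintype.sum_prod_type']
  -- Exchanging the summation indices outside `T` matches the two double sums term by term, since
  -- the operator entries factor over agents.
  refine Fintype.sum_equiv (exchangeEquiv T) _ _ fun p => ?_
  have h : tensorOp K x p.1 * tensorOp K y p.2 =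
      tensorOp K (T.piecewise x y) (T.piecewise p.1 p.2) *
        tensorOp K (T.piecewise y x) (T.piecewise p.2 p.1) := by
    simp only [tensorOp, of_apply, ← Finset.prod_mul_distrib]
    refine Finset.prod_congr rfl fun v _ => ?_
    by_cases hv : v ∈ T <;> simp [hv, mul_comm]
  simp only [exchangeEquiv, Equiv.coe_fn_mk]
  rw [mul_mul_mul_comm, h, hφ p.1 p.2, mul_mul_mul_comm]

/-- Unnormalized mixtures of pure product states across the cut `T | Tᶜ`. -/
def separable (T : Set V) : AddSubmonoid (Matrix (∀ v, α v) (∀ v, α v) ℂ) :=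
  AddSubmonoid.closure {ρ | ∃ φ, IsProductAcross T φ ∧ ρ = pureState φ}

theorem tensorOp_mul_mem_separable [∀ v, Fintype (α v)] {T : Set V}
    (K : ∀ v, Matrix (β v) (α v) ℂ) {ρ : Matrix (∀ v, α v) (∀ v, α v) ℂ}
    (hρ : ρ ∈ separable T) : tensorOp K * ρ * (tensorOp K)ᴴ ∈ separable T := by
  induction hρ using AddSubmonoid.closure_induction with
  | mem ρ h =>
    obtain ⟨φ, hφ, rfl⟩ := h
    rw [mul_pureState_mul_conjTranspose]
    exact AddSubmonoid.subset_closure ⟨_, hφ.tensorOp_mulVec K, rfl⟩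
  | zero => simp
  | add ρ σ _ _ h₁ h₂ =>
    rw [Matrix.mul_add, Matrix.add_mul]
    exact add_mem h₁ h₂

theorem LOCC.run_mem_separable {A B : V → QSystem} (P : LOCC A B) {T : Set V}
    {ρ : Matrix (∀ w, (A w).basis) (∀ w, (A w).basis) ℂ} (hρ : ρ ∈ separable T) :
    P.run ρ ∈ separable T := by
  induction P with
  | done A => exact hρ
  | round o K complete next ih =>
    rw [LOCC.run]
    exact sum_mem fun k _ => ih k (tensorOp_mul_mem_separable _ hρ)

omit [Fintype V] [DecidableEq V] in
open Classical in
-- For a product vector this is the minor identity followed by AM-GM; the bound survives sums by the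
-- triangle inequality.
theorem norm_apply_le_of_mem_separable {T : Set V} {ρ : Matrix (∀ v, α v) (∀ v, α v) ℂ}
    (hρ : ρ ∈ separable T) (x y : ∀ v, α v) :
    2 * ‖ρ x y‖ ≤ (ρ (T.piecewise x y) (T.piecewise x y)).re +
      (ρ (T.piecewise y x) (T.piecewise y x)).re := by
  induction hρ using AddSubmonoid.closure_induction with
  | mem ρ h =>
    obtain ⟨φ, hφ, rfl⟩ := h
    have h : ‖φ x‖ * ‖φ y‖ = ‖φ (T.piecewise x y)‖ * ‖φ (T.piecewise y x)‖ := by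
      rw [← norm_mul, hφ x y, norm_mul]
    have hre (z : ℂ) : (z * star z).re = ‖z‖ ^ 2 := by
      rw [RCLike.star_def, Complex.mul_conj, Complex.normSq_eq_norm_sq, Complex.ofReal_re]
    simp only [pureState, vecMulVec_apply, Pi.star_apply, hre, norm_mul, norm_star]
    rw [h]
    linarith [two_mul_le_add_sq ‖φ (T.piecewise x y)‖ ‖φ (T.piecewise y x)‖]
  | zero => simp
  | add ρ σ _ _ h₁ h₂ =>
    simp only [Matrix.add_apply, Complex.add_re]
    linarith [norm_add_le (ρ x y) (σ x y)]

theorem IsMaxEntangled.pureState_notMem_separable {ψ : (V → Fin 2) → ℂ} (hψ : IsMaxEntangled ψ)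
    {T : Set V} {a b : V} (ha : a ∈ T) (hb : b ∉ T) : pureState ψ ∉ separable T := by
  classical
  intro h
  obtain ⟨U, rfl⟩ := hψ
  -- Undoing the local unitaries stays in the cone, so the GHZ vector itself can be tested: its
  -- coherence between all-zeros and all-ones is nonzero, while both mixed strings have amplitude
  -- zero.
  have h' := tensorOp_mul_mem_separable
    (fun v => ((U v : Matrix (Fin 2) (Fin 2) ℂ))ᴴ) h
  rw [mul_pureState_mul_conjTranspose, mulVec_mulVec, tensorOp_mul] at h'
  have hU (v : V) : ((U v : Matrix (Fin 2) (Fin 2) ℂ))ᴴ * (U v : Matrix (Fin 2) (Fin 2) ℂ) = 1 :=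
    mem_unitaryGroup_iff'.1 (U v).2
  simp only [hU, tensorOp_one, one_mulVec] at h'
  have key := norm_apply_le_of_mem_separable h' (fun _ => 0) (fun _ => 1)
  have : Nonempty V := ⟨a⟩
  have h₁ : ghz V (T.piecewise (fun _ => 0) (fun _ => 1)) = 0 := ghz_eq_zero fun c hc => by
    have h₀ := congrFun hc a
    have h₁ := congrFun hc b
    simp only [ha, hb, Set.piecewise_eq_of_mem, Set.piecewise_eq_of_notMem,
      not_false_eq_true] at h₀ h₁
    exact absurd (h₀.trans h₁.symm) (by decide)
  have h₂ : ghz V (T.piecewise (fun _ => 1) (fun _ => 0)) = 0 := ghz_eq_zero fun c hc => by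
    have h₀ := congrFun hc a
    have h₁ := congrFun hc b
    simp only [ha, hb, Set.piecewise_eq_of_mem, Set.piecewise_eq_of_notMem,
      not_false_eq_true] at h₀ h₁
    exact absurd (h₀.trans h₁.symm) (by decide)
  have hpos : 0 < ‖pureState (ghz V) (fun _ => 0) (fun _ => 1)‖ := by
    simp [pureState, vecMulVec_apply, ghz_const]
  simp only [pureState, vecMulVec_apply, h₁, h₂, zero_mul, Complex.zero_re] at key hpos
  linarith

end Product

/-! ### Hyperpaths and functions constant on hyperedges -/

section Hyperpath

variable {α : Type*} {G : Hypergraph α}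

theorem Hypergraph.IsHyperpath.singleton {a b : α} {e : Set α} (he : e ∈ G.edgeSet) (ha : a ∈ e)
    (hb : b ∈ e) : G.IsHyperpath a b [e] := by
  simp [Hypergraph.IsHyperpath, he, ha, hb]

theorem Hypergraph.IsHyperpath.concat {a b c : α} {p : List (Set α)} {e : Set α}
    (hp : G.IsHyperpath a b p) (he : e ∈ G.edgeSet) (hb : b ∈ e) (hc : c ∈ e) :
    G.IsHyperpath a c (p ++ [e]) := by
  obtain ⟨h₁, ⟨f, hf, haf⟩, ⟨g, hg, hbg⟩, h₄⟩ := hp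
  refine ⟨?_, ⟨f, ?_, haf⟩, ⟨e, by simp, hc⟩, ?_⟩
  · intro e' he'
    rcases List.mem_append.1 he' with h | h
    · exact h₁ _ h
    · rw [List.mem_singleton.1 h]; exact he
  · rw [Option.mem_def] at hf ⊢
    simp [hf]
  · refine List.isChain_append.2 ⟨h₄, by simp, ?_⟩
    intro g' hg' e' he'
    obtain rfl : g' = g := Option.mem_unique hg' hg
    obtain rfl : e = e' := by simpa using he'
    exact ⟨b, hbg, hb⟩

theorem Hypergraph.IsHyperpath.apply_eq {β : Type*} {d : α → β}
    (hd : ∀ e ∈ G.edgeSet, ∀ u ∈ e, ∀ v ∈ e, d u = d v) {a b : α} {p : List (Set α)}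
    (hp : G.IsHyperpath a b p) : d a = d b := by
  induction p generalizing a with
  | nil => obtain ⟨_, ⟨_, h, _⟩, _⟩ := hp; simp at h
  | cons e p ih =>
    obtain ⟨h₁, ⟨f, hf, haf⟩, ⟨g, hg, hbg⟩, h₄⟩ := hp
    obtain rfl : e = f := by simpa using hf
    have he : e ∈ G.edgeSet := h₁ e (by simp)
    cases p with
    | nil =>
      obtain rfl : e = g := by simpa using hg
      exact hd e he a haf b hbg
    | cons e' p =>
      obtain ⟨⟨c, hc, hc'⟩, h₅⟩ := List.isChain_cons_cons.1 h₄
      refine (hd e he a haf c hc).trans (ih ⟨fun e'' h => h₁ e'' (by simp [h]), ?_, ?_, h₅⟩)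
      · exact ⟨e', by simp, hc'⟩
      · exact ⟨g, by simpa [List.getLast?_cons_cons] using hg, hbg⟩

theorem Hypergraph.IsHyperconnected.apply_eq {β : Type*} {d : α → β} (hG : G.IsHyperconnected)
    (hd : ∀ e ∈ G.edgeSet, ∀ u ∈ e, ∀ v ∈ e, d u = d v) {a b : α} (ha : a ∈ G.vertexSet)
    (hb : b ∈ G.vertexSet) : d a = d b := by
  by_cases h : a = b
  · rw [h]
  · obtain ⟨p, hp⟩ := hG a ha b hb h
    exact hp.apply_eq hd

end Hyperpath

/-! ### Necessity of connectedness -/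

section Necessity

variable {V : Type*} [Fintype V] [DecidableEq V] {m : ℕ} (H : EntangledHypergraph V m)

theorem EntangledHypergraph.isProductAcross_initialState {T : Set V}
    (hT : ∀ j, ∀ u ∈ H.edge j, ∀ v ∈ H.edge j, u ∈ T → v ∈ T) :
    IsProductAcross T H.initialState := by
  classical
  intro x y
  simp only [EntangledHypergraph.initialState, ← Finset.prod_mul_distrib]
  refine Finset.prod_congr rfl fun j _ => ?_
  by_cases h : ∃ u ∈ H.edge j, u ∈ T
  · obtain ⟨u, hu, huT⟩ := h
    have hv (v : H.edge j) : v.1 ∈ T := hT j u hu v v.2 huT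
    simp [hv]
  · push Not at h
    have hv (v : H.edge j) : v.1 ∉ T := h v v.2
    simp [hv, mul_comm]

theorem EntangledHypergraph.isHyperconnected_of_preparable {ψ : (V → Fin 2) → ℂ}
    (hψ : IsMaxEntangled ψ)
    (h : LOCCPreparable (A := H.system) (B := fun _ => QSystem.qubit) H.initialState ψ) :
    H.toHypergraph.IsHyperconnected := by
  intro a _ b _ hab
  by_contra hp
  obtain ⟨P, hP⟩ := h
  -- The guard `a ≠ v` puts `a` in `T` even when no hyperedge contains it.
  let T : Set V := {v | a ≠ v → ∃ p, H.toHypergraph.IsHyperpath a v p}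
  have hT : ∀ j, ∀ u ∈ H.edge j, ∀ v ∈ H.edge j, u ∈ T → v ∈ T := by
    intro j u hu v hv huT _
    have he : (H.edge j : Set V) ∈ H.toHypergraph.edgeSet := ⟨j, rfl⟩
    by_cases hau : a = u
    · subst hau
      exact ⟨_, .singleton he hu hv⟩
    · obtain ⟨p, hp⟩ := huT hau
      exact ⟨_, hp.concat he hu hv⟩
  have ha : a ∈ T := fun h => absurd rfl h
  have hb : b ∉ T := fun h => hp (h hab)
  have hsep := P.run_mem_separable (T := T)
    (AddSubmonoid.subset_closure ⟨_, H.isProductAcross_initialState hT, rfl⟩)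
  rw [hP] at hsep
  exact hψ.pureState_notMem_separable ha hb hsep

end Necessity

/-! ### Sufficiency of connectedness -/

section Sufficiency

namespace EntangledHypergraph

variable {V : Type*} [Fintype V] [DecidableEq V] {m : ℕ} (H : EntangledHypergraph V m)

/-- Assignments of bits to incident pairs, grouped by hyperedge instead of by agent. -/
def regroupEquiv :
    (∀ v, {j : Fin m // v ∈ H.edge j} → Fin 2) ≃ (∀ j, H.edge j → Fin 2) where
  toFun x j v := x v.1 ⟨j, v.2⟩
  invFun y v j := y j.1 ⟨v, j.2⟩
  left_inv _ := rfl
  right_inv _ := rfl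

theorem sum_prod_edge (f : ∀ j, (H.edge j → Fin 2) → ℂ) :
    ∑ x : (∀ v, {j : Fin m // v ∈ H.edge j} → Fin 2), ∏ j, f j (fun v => x v.1 ⟨j, v.2⟩) =
      ∏ j, ∑ y, f j y := by
  rw [Finset.prod_univ_sum, Fintype.piFinset_univ]
  exact Fintype.sum_equiv H.regroupEquiv _ _ fun _ => rfl

theorem star_initialState_dotProduct_initialState :
    star H.initialState ⬝ᵥ H.initialState = 1 := by
  have h := H.sum_prod_edge fun j y => star (H.state j y) * H.state j y
  simp only [Finset.prod_mul_distrib] at h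
  have h' : star H.initialState ⬝ᵥ H.initialState =
      ∏ j, ∑ y, star (H.state j y) * H.state j y := by
    rw [← h]
    simp only [dotProduct, Pi.star_apply, initialState, star_prod]
    rfl
  rw [h']
  refine Finset.prod_eq_one fun j _ => ?_
  have : Nonempty (H.edge j) := (H.edge_nonempty j).to_subtype
  exact (H.isMaxEntangled_state j).star_dotProduct_self

/-- The product of the standard states `(|00…0⟩ + |11…1⟩) / √2` of the hyperedges. -/
noncomputable def ghzProduct : (∀ v, {j : Fin m // v ∈ H.edge j} → Fin 2) → ℂ :=
  fun x => ∏ j, ghz (H.edge j) fun v => x v.1 ⟨j, v.2⟩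

theorem prod_incidence (f : ∀ v j, v ∈ H.edge j → ℂ) :
    ∏ j, ∏ v : H.edge j, f v j v.2 = ∏ v, ∏ j : {j : Fin m // v ∈ H.edge j}, f v j j.2 := by
  rw [← Fintype.prod_sigma', ← Fintype.prod_sigma']
  exact Fintype.prod_equiv
    { toFun := fun p => ⟨p.2.1, p.1, p.2.2⟩
      invFun := fun p => ⟨p.2.1, p.1, p.2.2⟩
      left_inv := fun _ => rfl
      right_inv := fun _ => rfl } _ _ fun _ => rfl

/-- Each agent's unitary is the tensor product, over its hyperedges, of the unitaries acting on its
qubits; the incidences are regrouped from hyperedges to agents. -/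
theorem exists_initialState_eq : ∃ U : ∀ v,
    Matrix.unitaryGroup ({j : Fin m // v ∈ H.edge j} → Fin 2) ℂ,
    H.initialState = tensorOp (fun v => (U v).1) *ᵥ H.ghzProduct := by
  choose U hU using H.isMaxEntangled_state
  refine ⟨fun v => ⟨tensorOp fun j => (U j.1 ⟨v, j.2⟩).1, mem_unitaryGroup_iff'.2 ?_⟩, ?_⟩
  · exact tensorOp_conjTranspose_mul_self _ fun j => mem_unitaryGroup_iff'.1 (U _ _).2
  · funext x
    have h := H.sum_prod_edge fun j y =>
      tensorOp (fun v => (U j v).1) (fun v => x v.1 ⟨j, v.2⟩) y * ghz (H.edge j) y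
    simp only [initialState, hU]
    refine h.symm.trans (Finset.sum_congr rfl fun y _ => ?_)
    rw [Finset.prod_mul_distrib]
    refine congrArg (· * _) ?_
    exact H.prod_incidence fun v j h => (U j ⟨v, h⟩).1 (x v ⟨j, h⟩) (y v ⟨j, h⟩)

end EntangledHypergraph

/-- The Kraus operator `(|0⟩⟨y| + |1⟩⟨ȳ|) / √2`, where `ȳ` is the bitwise complement of `y`. -/
noncomputable def parityKraus {J : Type*} [Fintype J] (y : J → Fin 2) :
    Matrix (Fin 2) (J → Fin 2) ℂ :=
  Matrix.of fun z x => if x = fun j => y j + z then 1 / ((Real.sqrt 2 : ℝ) : ℂ) else 0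

theorem sum_parityKraus {J : Type*} [Fintype J] [DecidableEq J] :
    ∑ y : J → Fin 2, (parityKraus y)ᴴ * parityKraus y = 1 := by
  have h : ((Real.sqrt 2 : ℝ) : ℂ) * ((Real.sqrt 2 : ℝ) : ℂ) = 2 := by
    rw [← Complex.ofReal_mul, Real.mul_self_sqrt (by norm_num)]; norm_num
  have h0 : ((Real.sqrt 2 : ℝ) : ℂ) ≠ 0 := by simp
  -- For fixed `x` and `z` exactly one outcome `y` contributes, with weight 1/2; the two values of
  -- `z` give total 1, also for empty `J`.
  have hs (z : Fin 2) (x y : J → Fin 2) : (x = fun j => y j + z) ↔ y = fun j => x j + z := by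
    have (a b c : Fin 2) : a = b + c ↔ b = a + c := by revert a b c; decide
    simp only [funext_iff, this]
  ext x x'
  simp only [Matrix.sum_apply, mul_apply, conjTranspose_apply, parityKraus, of_apply]
  rw [Finset.sum_comm]
  simp only [hs _ x, hs _ x', apply_ite star, star_zero, ite_mul, zero_mul,
    Finset.sum_ite_eq', Finset.mem_univ, if_true]
  have hc (z : Fin 2) : ((fun j => x j + z) = fun j => x' j + z) ↔ x = x' := by
    simp [funext_iff]
  simp only [hc, one_apply, RCLike.star_def, map_div₀, map_one, Complex.conj_ofReal]
  split_ifs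
  · rw [Fin.sum_univ_two]
    field_simp
    rw [sq, h]; norm_num
  · simp

section

variable {V : Type*} [Fintype V] [DecidableEq V]

theorem tensorOp_parityKraus_mulVec {J : V → Type*} [∀ v, Fintype (J v)] [∀ v, DecidableEq (J v)]
    (y : ∀ v, J v → Fin 2) (φ : (∀ v, J v → Fin 2) → ℂ) (z : V → Fin 2) :
    (tensorOp (fun v => parityKraus (y v)) *ᵥ φ) z =
      (1 / ((Real.sqrt 2 : ℝ) : ℂ)) ^ Fintype.card V * φ fun v j => y v j + z v := by
  simp only [mulVec, dotProduct, tensorOp, of_apply, parityKraus]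
  rw [Fintype.sum_eq_single fun v j => y v j + z v]
  · simp
  · intro x hx
    obtain ⟨v, hv⟩ := Function.ne_iff.1 hx
    rw [Finset.prod_eq_zero (Finset.mem_univ v) (if_neg hv), zero_mul]

/-- The permutation matrix of `|x⟩ ↦ |x + b⟩` on a qubit. -/
def bitFlip (b : Fin 2) : Matrix (Fin 2) (Fin 2) ℂ :=
  Matrix.of fun z x => if x = z + b then 1 else 0

theorem conjTranspose_bitFlip_mul_bitFlip (b : Fin 2) : (bitFlip b)ᴴ * bitFlip b = 1 := by
  ext i j
  fin_cases b <;> fin_cases i <;> fin_cases j <;>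
    simp [bitFlip, mul_apply, one_apply, conjTranspose_apply]

theorem tensorOp_bitFlip_mulVec (b : V → Fin 2) (φ : (V → Fin 2) → ℂ) (z : V → Fin 2) :
    (tensorOp (fun v => bitFlip (b v)) *ᵥ φ) z = φ fun v => z v + b v := by
  simp only [mulVec, dotProduct, tensorOp, of_apply, bitFlip]
  rw [Fintype.sum_eq_single fun v => z v + b v]
  · simp
  · intro x hx
    obtain ⟨v, hv⟩ := Function.ne_iff.1 hx
    rw [Finset.prod_eq_zero (Finset.mem_univ v) (if_neg hv), zero_mul]

omit [DecidableEq V] in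
theorem eq_smul_ghz [Nonempty V] {φ : (V → Fin 2) → ℂ}
    (h₀ : ∀ z, (∀ b, z ≠ fun _ => b) → φ z = 0) (h₁ : φ (fun _ => 1) = φ fun _ => 0) :
    ∃ c : ℂ, φ = c • ghz V := by
  refine ⟨φ (fun _ => 0) * ((Real.sqrt 2 : ℝ) : ℂ), funext fun z => ?_⟩
  have h2 : ((Real.sqrt 2 : ℝ) : ℂ) ≠ 0 := by simp
  rw [Pi.smul_apply, smul_eq_mul]
  by_cases hz : ∃ b, z = fun _ => b
  · obtain ⟨b, rfl⟩ := hz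
    rw [ghz_const, mul_assoc, mul_one_div_cancel h2, mul_one]
    fin_cases b
    exacts [rfl, h₁]
  · push Not at hz
    rw [h₀ z hz, ghz_eq_zero hz, mul_zero]

end

namespace EntangledHypergraph

variable {V : Type*} [Fintype V] [DecidableEq V] {m : ℕ} (H : EntangledHypergraph V m)

theorem ghzProduct_add_one (x : ∀ v, {j : Fin m // v ∈ H.edge j} → Fin 2) :
    (H.ghzProduct fun v j => x v j + 1) = H.ghzProduct x :=
  Finset.prod_congr rfl fun j _ => ghz_add_one (W := H.edge j) fun v => x v.1 ⟨j, v.2⟩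

/-- On each hyperedge both `x` and its shift are constant, hence so is `z`; connectivity makes it
globally constant. -/
theorem exists_eq_const_of_ghzProduct_ne_zero (hH : H.toHypergraph.IsHyperconnected) [Nonempty V]
    {x : ∀ v, {j : Fin m // v ∈ H.edge j} → Fin 2} {z : V → Fin 2} (hx : H.ghzProduct x ≠ 0)
    (hz : (H.ghzProduct fun v j => x v j + z v) ≠ 0) : ∃ b, z = fun _ => b := by
  obtain ⟨a⟩ := ‹Nonempty V›
  refine ⟨z a, funext fun v => hH.apply_eq ?_ (Set.mem_univ v) (Set.mem_univ a)⟩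
  rintro _ ⟨j, rfl⟩ u hu v hv
  obtain ⟨b, hb⟩ := eq_const_of_ghz_ne_zero (Finset.prod_ne_zero_iff.1 hx j (Finset.mem_univ j))
  obtain ⟨c, hc⟩ := eq_const_of_ghz_ne_zero (Finset.prod_ne_zero_iff.1 hz j (Finset.mem_univ j))
  have hbu := congrFun hb ⟨u, hu⟩
  have hbv := congrFun hb ⟨v, hv⟩
  have hcu := congrFun hc ⟨u, hu⟩
  have hcv := congrFun hc ⟨v, hv⟩
  simp only at hbu hbv hcu hcv
  rw [hbu] at hcu
  rw [hbv] at hcv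
  exact add_left_cancel (hcu.trans hcv.symm)

theorem exists_bitFlip_mulVec_eq_smul_ghz (hH : H.toHypergraph.IsHyperconnected) [Nonempty V]
    (y : ∀ v, {j : Fin m // v ∈ H.edge j} → Fin 2) :
    ∃ (b : V → Fin 2) (c : ℂ), tensorOp (fun v => bitFlip (b v)) *ᵥ
      (tensorOp (fun v => parityKraus (y v)) *ᵥ H.ghzProduct) = c • ghz V := by
  by_cases h : ∃ b : V → Fin 2, (H.ghzProduct fun v j => y v j + b v) ≠ 0
  · obtain ⟨b, hb⟩ := h
    refine ⟨b, eq_smul_ghz ?_ ?_⟩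
    · intro z hz
      rw [tensorOp_bitFlip_mulVec, tensorOp_parityKraus_mulVec]
      by_contra hne
      have hne' := right_ne_zero_of_mul hne
      simp only [add_comm (z _), ← add_assoc] at hne'
      obtain ⟨c, hc⟩ := H.exists_eq_const_of_ghzProduct_ne_zero hH hb hne'
      exact hz c hc
    · simp only [tensorOp_bitFlip_mulVec, tensorOp_parityKraus_mulVec]
      simp only [zero_add, add_comm (1 : Fin 2), ← add_assoc]
      rw [H.ghzProduct_add_one]
  -- All amplitudes vanish: an outcome of probability zero, covered by `c = 0`.
  · push Not at h
    refine ⟨0, 0, funext fun z => ?_⟩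
    rw [tensorOp_bitFlip_mulVec, tensorOp_parityKraus_mulVec, h]
    simp

theorem preparable_of_isHyperconnected [Nonempty V] {ψ : (V → Fin 2) → ℂ} (hψ : IsMaxEntangled ψ)
    (hH : H.toHypergraph.IsHyperconnected) :
    LOCCPreparable (A := H.system) (B := fun _ => QSystem.qubit) H.initialState ψ := by
  obtain ⟨L, hL⟩ := H.exists_initialState_eq
  have hψ₁ := hψ.star_dotProduct_self
  obtain ⟨U, rfl⟩ := hψ
  choose b c hbc using H.exists_bitFlip_mulVec_eq_smul_ghz hH
  let o (v : V) : ℕ := Fintype.card ({j : Fin m // v ∈ H.edge j} → Fin 2)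
  let y (k : ∀ v, Fin (o v)) (v : V) : {j : Fin m // v ∈ H.edge j} → Fin 2 :=
    (Fintype.equivFin _).symm (k v)
  let K (v : V) (i : Fin (o v)) : Matrix (Fin 2) ({j : Fin m // v ∈ H.edge j} → Fin 2) ℂ :=
    parityKraus ((Fintype.equivFin _).symm i) * (L v).1ᴴ
  have hK (v : V) : ∑ i, (K v i)ᴴ * K v i = 1 := by
    have hLL : (L v).1 * (L v).1ᴴ = 1 := mem_unitaryGroup_iff.1 (L v).2
    simp only [K, conjTranspose_mul, conjTranspose_conjTranspose]
    simp only [Matrix.mul_assoc, ← Finset.mul_sum]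
    simp only [← Matrix.mul_assoc (parityKraus _)ᴴ, ← Finset.sum_mul]
    rw [Equiv.sum_comp (Fintype.equivFin ({j : Fin m // v ∈ H.edge j} → Fin 2)).symm
      fun y => (parityKraus y)ᴴ * parityKraus y, sum_parityKraus, Matrix.one_mul, hLL]
  let R (k : ∀ v, Fin (o v)) (v : V) : Matrix (Fin 2) (Fin 2) ℂ := (U v).1 * bitFlip (b (y k) v)
  have hR (k : ∀ v, Fin (o v)) (v : V) : ∑ _i : Fin 1, (R k v)ᴴ * R k v = 1 := by
    have hUU : (U v).1ᴴ * (U v).1 = 1 := mem_unitaryGroup_iff'.1 (U v).2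
    rw [Fin.sum_univ_one]
    simp only [R, conjTranspose_mul]
    rw [Matrix.mul_assoc, ← Matrix.mul_assoc _ (U v).1, hUU, Matrix.one_mul,
      conjTranspose_bitFlip_mul_bitFlip]
  let P : LOCC H.system (fun _ : V => QSystem.qubit) :=
    .round (B := fun _ => QSystem.qubit) o K hK fun k =>
      .round (B := fun _ => QSystem.qubit) (fun _ => 1) (fun v _ => R k v) (hR k) fun _ => .done _
  refine ⟨P, ?_⟩
  have hφ (k : ∀ v, Fin (o v)) : tensorOp (R k) *ᵥ (tensorOp (fun v => K v (k v)) *ᵥ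
      H.initialState) = c (y k) • (tensorOp (fun v => (U v).1) *ᵥ ghz V) := by
    have hLL (v : V) : (L v).1ᴴ * (L v).1 = 1 := mem_unitaryGroup_iff'.1 (L v).2
    simp only [R, K]
    rw [← tensorOp_mul, ← tensorOp_mul, hL, ← mulVec_mulVec, ← mulVec_mulVec,
      mulVec_mulVec _ (tensorOp fun v => (L v).1ᴴ), tensorOp_mul]
    simp only [hLL, tensorOp_one, one_mulVec]
    rw [hbc (y k), mulVec_smul]
  have hrun : P.run (pureState H.initialState) = (∑ k, c (y k) * star (c (y k))) •
      pureState (tensorOp (fun v => (U v).1) *ᵥ ghz V) := by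
    rw [Finset.sum_smul]
    refine Finset.sum_congr rfl fun k _ => (Fintype.sum_unique (ι := V → Fin 1) _).trans ?_
    refine (congrArg (fun ρ : Matrix (V → Fin 2) (V → Fin 2) ℂ =>
      tensorOp (R k) * ρ * (tensorOp (R k))ᴴ)
      (mul_pureState_mul_conjTranspose _ _)).trans ?_
    refine (mul_pureState_mul_conjTranspose _ _).trans ?_
    exact (congrArg pureState (hφ k)).trans (pureState_smul _ _)
  -- Every branch ends in a multiple of the same unit vector, so comparing traces before and after
  -- fixes the total weight.
  have hone : ∑ k, c (y k) * star (c (y k)) = 1 := by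
    have htr := (congrArg trace hrun).symm.trans (P.trace_run (pureState H.initialState))
    have h₁ : (pureState H.initialState).trace = 1 :=
      (trace_pureState _).trans H.star_initialState_dotProduct_initialState
    have h₂ : (pureState (tensorOp (fun v => (U v).1) *ᵥ ghz V)).trace = 1 :=
      (trace_pureState _).trans hψ₁
    have h₃ := (trace_smul (∑ k, c (y k) * star (c (y k)))
      (pureState (tensorOp (fun v => (U v).1) *ᵥ ghz V))).symm.trans (htr.trans h₁)
    rwa [h₂, smul_eq_mul, mul_one] at h₃
  rw [hrun, hone, one_smul]
  rfl

end EntangledHypergraph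

end Sufficiency

theorem mainTheorem2 {V : Type*} [Fintype V] [DecidableEq V] [Nonempty V] {m : ℕ}
    (H : EntangledHypergraph V m) (ψ : (V → Fin 2) → ℂ) (hψ : IsMaxEntangled ψ) :
    LOCCPreparable (A := H.system) (B := fun _ => QSystem.qubit) H.initialState ψ ↔
      H.toHypergraph.IsHyperconnected :=
  ⟨H.isHyperconnected_of_preparable hψ, H.preparable_of_isHyperconnected hψ⟩
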